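/- Put $\mathbb{R}_+=(0,\infty)$ and let $G=\{(u,v):u\in\mathbb{R},\,v>0\}$ carry the measure $d\nu=v^{-2}\,du\,dv$. For $k\in\{0,1,2,\dots\}$ let $\ell_k(y)=e^{-y/2}L_k(y)$, where $L_k(y)=\sum_{i=0}^k(-1)^i\binom{k}{k-i}\frac{y^i}{i!}$ is the Laguerre polynomial. Let $\psi^{(k)}$ be the function on $\mathbb{R}$ whose Fourier transform (with kernel $e^{-2\pi i x\xi}$) is $\hat\psi^{(k)}(\xi)=\sqrt{2\xi}\,\ell_k(2\xi)$ for $\xi>0$ and $0$ for $\xi\le 0$, and put $\psi^{(k)}_v(u)=v^{-1/2}\psi^{(k)}(u/v)$. Let $H_2^+(\mathbb{R})$ be the space of $h\in L_2(\mathbb{R})$ with $\operatorname{supp}\hat h\subseteq[0,\infty)$, let $A^{(k)}=\{(u,v)\mapsto (f*\psi^{(k)}_v)(u): f\in H_2^+(\mathbb{R})\}$, which is a closed subspace of $L_2(G,d\nu)$, and let $P^{(k)}$ be the orthogonal projection of $L_2(G,d\nu)$ onto $A^{(k)}$. For a bounded measurable symbol $a$ on $G$ the Calderón–Toeplitz operator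 on $A^{(k)}$ is $T_a^{(k)}f=P^{(k)}(af)$. Let $\mathcal{A}_\infty$ be the algebra of all (essentially) bounded measurable symbols $a=a(v)$ on $G$ depending only on $v$, let $\mathcal{T}_k(\mathcal{A}_\infty)$ be the $C^*$-algebra of operators on $A^{(k)}$ generated by all $T_a^{(k)}$, $a\in\mathcal{A}_\infty$, and for $a\in\mathcal{A}_\infty$ let $$\gamma_{a,k}(\xi)=\int_0^\infty a\!\left(\frac{v}{2\xi}\right)\ell_k(v)^2\,dv,\qquad \xi\in\mathbb{R}_+ .$$ Then for every $k$ the algebra $\mathcal{T}_k(\mathcal{A}_\infty)$ is commutative; the integral defining $\gamma_{a,k}(\xi)$ converges absolutely for all $a\in\mathcal{A}_\infty$ and $\xi\in\mathbb{R}_+$; and there is a unique isometric $*$-homomorphism $$\tau_\infty^{(k)}:\mathcal{T}_k(\mathcal{A}_\infty)\longrightarrow C_b(\mathbb{R}_+)$$ into the algebra of bounded continuous complex functions on $\mathbb{R}_+$ (with the supremum norm) such that $\tau_\infty^{(k)}(T_a^{(k)})=\gamma_{a,k}$ for all $a\in\mathcal{A}_\infty$. -/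

import Mathlib

open MeasureTheory FourierTransform
open scoped ENNReal

namespace CalderonToeplitz

noncomputable section

/-- The Laguerre polynomial `L_k` of degree `k` and type `0`,
`L_k(y) = ∑_{i=0}^k (-1)^i binom(k, k-i) y^i / i!`. -/
def laguerrePoly (k : ℕ) (y : ℝ) : ℝ :=
  ∑ i ∈ Finset.range (k + 1), (-1) ^ i * (k.choose (k - i) : ℝ) * (y ^ i / (i.factorial : ℝ))

/-- The Laguerre function `ℓ_k(y) = e^{-y/2} L_k(y)`. -/
def laguerreFun (k : ℕ) (y : ℝ) : ℝ := Real.exp (-y / 2) * laguerrePoly k y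

/-- The Fourier transform of the wavelet: `χ_+(ξ) √(2ξ) ℓ_k(2ξ)`. -/
def waveletHat (k : ℕ) (ξ : ℝ) : ℂ :=
  if 0 < ξ then ((√(2 * ξ) * laguerreFun k (2 * ξ) : ℝ) : ℂ) else 0

/-- The wavelet `ψ^{(k)}`: the inverse Fourier transform
`x ↦ ∫ e^{2πixξ} waveletHat k ξ dξ` of the integrable function `waveletHat k`. -/
def wavelet (k : ℕ) : ℝ → ℂ := 𝓕⁻ (waveletHat k)

/-- The dilation `ψ_v(u) = v^{-1/2} ψ(u / v)`. -/
def dilate (v : ℝ) (ψ : ℝ → ℂ) (u : ℝ) : ℂ := ((√v)⁻¹ : ℝ) * ψ (u / v)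

/-- The continuous wavelet transform `(W_k f)(u, v) = (f * ψ^{(k)}_v)(u)`, at `p = (u, v)`. -/
def waveletTransform (k : ℕ) (f : ℝ → ℂ) (p : ℝ × ℝ) : ℂ :=
  (convolution f (dilate p.2 (wavelet k)) (ContinuousLinearMap.mul ℂ ℂ) volume) p.1

/-- The left Haar measure `v^{-2} du dv` of the affine group `G = {(u, v) : v > 0}`, as a measure
on `ℝ × ℝ` carried by the upper half-plane; `L_2(G, dν)` is `Lp ℂ 2 affineHaar`. -/
def affineHaar : Measure (ℝ × ℝ) :=
  (volume : Measure ℝ).prod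
    ((volume.restrict (Set.Ioi (0 : ℝ))).withDensity fun v => ENNReal.ofReal (v ^ 2)⁻¹)

lemma continuous_laguerreFun (k : ℕ) : Continuous (laguerreFun k) := by
  unfold laguerreFun laguerrePoly
  fun_prop

lemma waveletHat_eq (k : ℕ) (ξ : ℝ) :
    waveletHat k ξ = ((√(2 * ξ) * laguerreFun k (2 * ξ) : ℝ) : ℂ) := by
  unfold waveletHat
  split_ifs with h
  · rfl
  · rw [Real.sqrt_eq_zero_of_nonpos (by linarith)]; simp

lemma continuous_waveletHat (k : ℕ) : Continuous (waveletHat k) := by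
  have : waveletHat k = fun ξ => ((√(2 * ξ) * laguerreFun k (2 * ξ) : ℝ) : ℂ) :=
    funext (waveletHat_eq k)
  rw [this]
  have := continuous_laguerreFun k
  fun_prop

lemma exists_laguerrePoly_bound (k : ℕ) :
    ∃ D : ℝ, 0 ≤ D ∧ ∀ y : ℝ, 0 ≤ y → |laguerrePoly k y| ≤ D * Real.exp (y / 4) := by
  set D : ℝ := ∑ i ∈ Finset.range (k + 1), (k.choose (k - i) : ℝ) * 4 ^ i with hD
  have hD0 : 0 ≤ D := by positivity
  refine ⟨D, hD0, fun y hy => ?_⟩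
  · unfold laguerrePoly
    refine (Finset.abs_sum_le_sum_abs _ _).trans ?_
    rw [hD, Finset.sum_mul]
    refine Finset.sum_le_sum fun i _ => ?_
    have h1 := Real.pow_div_factorial_le_exp (y / 4) (by positivity) i
    have h2 : y ^ i / (i.factorial : ℝ) = 4 ^ i * ((y / 4) ^ i / (i.factorial : ℝ)) := by
      rw [div_pow]; field_simp
    rw [abs_mul, abs_mul, abs_pow, abs_neg, abs_one, one_pow, one_mul, Nat.abs_cast,
      abs_of_nonneg (by positivity), h2, mul_assoc]
    gcongr

lemma exists_waveletHat_bound (k : ℕ) :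
    ∃ C : ℝ, 0 ≤ C ∧ ∀ ξ, ‖waveletHat k ξ‖ ≤ C * Real.exp (-(ξ / 4)) := by
  obtain ⟨D, hD0, hL⟩ := exists_laguerrePoly_bound k
  refine ⟨8 * D, by positivity, fun ξ => ?_⟩
  unfold waveletHat
  split_ifs with h
  · rw [Complex.norm_real, Real.norm_eq_abs, abs_mul, abs_of_nonneg (Real.sqrt_nonneg _)]
    unfold laguerreFun
    rw [abs_mul, abs_of_nonneg (Real.exp_nonneg _)]
    have h1 := hL (2 * ξ) (by positivity)
    have h2 : √(2 * ξ) ≤ 8 * Real.exp (ξ / 4) := by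
      have e1 := Real.add_one_le_exp (ξ / 4)
      have e2 : √(2 * ξ) ≤ 1 + 2 * ξ := by
        rw [Real.sqrt_le_left (by positivity)]; nlinarith
      linarith
    calc √(2 * ξ) * (Real.exp (-(2 * ξ) / 2) * |laguerrePoly k (2 * ξ)|)
        ≤ (8 * Real.exp (ξ / 4)) * (Real.exp (-(2 * ξ) / 2) * (D * Real.exp (2 * ξ / 4))) := by
          gcongr
      _ = 8 * D * (Real.exp (ξ / 4) * Real.exp (-(2 * ξ) / 2) * Real.exp (2 * ξ / 4)) := by ring
      _ = _ := by rw [← Real.exp_add, ← Real.exp_add]; congr 2; ring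
  · simp only [norm_zero]; positivity

lemma waveletHat_of_nonpos (k : ℕ) {ξ : ℝ} (h : ξ ≤ 0) : waveletHat k ξ = 0 := by
  simp [waveletHat, not_lt.mpr h]

lemma exists_waveletHat_bound' (k : ℕ) : ∃ C : ℝ, ∀ ξ, ‖waveletHat k ξ‖ ≤ C := by
  obtain ⟨C, h0, hC⟩ := exists_waveletHat_bound k
  refine ⟨C, fun ξ => ?_⟩
  rcases le_or_gt ξ 0 with h | h
  · rw [waveletHat_of_nonpos k h]; simpa
  · refine (hC ξ).trans (mul_le_of_le_one_right h0 ?_)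
    rw [Real.exp_le_one_iff]; linarith

lemma integrable_waveletHat (k : ℕ) : Integrable (waveletHat k) := by
  obtain ⟨C, h0, hC⟩ := exists_waveletHat_bound k
  have h1 : IntegrableOn (fun ξ => C * Real.exp (-(ξ / 4))) (Set.Ioi 0) := by
    have h : IntegrableOn (fun ξ : ℝ => C * Real.exp (-(1 / 4) * ξ)) (Set.Ioi 0) :=
      (exp_neg_integrableOn_Ioi 0 (b := 1 / 4) (by norm_num)).const_mul C
    refine h.congr_fun (fun x _ => ?_) measurableSet_Ioi
    simp only; congr 2; ring
  have h2 : IntegrableOn (waveletHat k) (Set.Ioi 0) :=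
    h1.mono' (continuous_waveletHat k).aestronglyMeasurable (.of_forall hC)
  refine (integrableOn_iff_integrable_of_support_subset fun x hx => ?_).1 h2
  by_contra h
  exact hx (waveletHat_of_nonpos k (not_lt.1 h))

lemma memLp_waveletHat (k : ℕ) : MemLp (waveletHat k) 2 := by
  obtain ⟨C, hC⟩ := exists_waveletHat_bound' k
  rw [memLp_two_iff_integrable_sq_norm (continuous_waveletHat k).aestronglyMeasurable]
  simp_rw [pow_two]
  exact (integrable_waveletHat k).norm.bdd_mul (c := C)
    (continuous_waveletHat k).norm.aestronglyMeasurable (.of_forall fun x => by simpa using hC x)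

lemma continuous_fourierInv {g : ℝ → ℂ} (h1 : Integrable g) : Continuous (𝓕⁻ g) := by
  rw [Real.fourierInv_eq_fourier_comp_neg]
  exact VectorFourier.fourierIntegral_continuous Real.continuous_fourierChar
    (by exact continuous_inner) h1.comp_neg

lemma fourierInv_toLp {g : ℝ → ℂ} (h1 : Integrable g) (h2 : MemLp g 2) :
   ((𝓕⁻ (h2.toLp g) : Lp ℂ 2 (volume : Measure ℝ)) : ℝ → ℂ) =ᵐ[volume] 𝓕⁻ g := by
  apply ae_eq_of_integral_contDiff_smul_eq
  · exact (Lp.memLp _).locallyIntegrable (by norm_num)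
  · exact (continuous_fourierInv h1).locallyIntegrable
  · intro φ hφ hc
    have hc' : HasCompactSupport (fun x => (φ x : ℂ)) := hc.comp_left (g := fun x : ℝ => (x : ℂ)) (by simp)
    have hs : ContDiff ℝ (⊤ : ℕ∞) (fun x => (φ x : ℂ)) := Complex.ofRealCLM.contDiff.comp hφ
    set Φ := hc'.toSchwartzMap hs with hΦ
    have hΦc : ∀ x, Φ x = φ x := fun x => rfl
    have e1 := congrArg (fun T : TemperedDistribution ℝ ℂ => T Φ)
      (Lp.fourierInv_toTemperedDistribution_eq (h2.toLp g))
    simp only [TemperedDistribution.fourierInv_apply, Lp.toTemperedDistribution_apply] at e1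
    have e2 : ∫ x, φ x • (𝓕⁻ (h2.toLp g) : Lp ℂ 2 (volume : Measure ℝ)) x =
        ∫ x, Φ x • (𝓕⁻ (h2.toLp g) : Lp ℂ 2 (volume : Measure ℝ)) x := by
      refine integral_congr_ae (.of_forall fun x => ?_)
      simp [hΦc]
    rw [e2, ← e1]
    have e3 : ∫ x, (𝓕⁻ Φ) x • (h2.toLp g) x = ∫ x, (𝓕⁻ Φ) x • g x := by
      refine integral_congr_ae ?_
      filter_upwards [h2.coeFn_toLp] with x hx
      rw [hx]
    rw [e3, SchwartzMap.fourierInv_coe]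
    have e4 : ∫ x, φ x • 𝓕⁻ g x = ∫ x, Φ x • 𝓕⁻ g x := by
      refine integral_congr_ae (.of_forall fun x => ?_)
      simp [hΦc]
    rw [e4, Real.fourierInv_eq_fourier_comp_neg g, Real.fourierInv_eq_fourier_comp_neg]
    have := VectorFourier.integral_fourierIntegral_smul_eq_flip (e := Real.fourierChar)
      (μ := volume) (ν := volume) (L := innerₗ ℝ)
      Real.continuous_fourierChar (by exact continuous_inner) (Φ.integrable (μ := volume)).comp_neg h1
    rw [flip_innerₗ] at this
    have e5 : (∫ x, 𝓕 (fun x => Φ (-x)) x • g x) = ∫ x, Φ (-x) • 𝓕 g x := this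
    have e6 : 𝓕 (fun x => g (-x)) = fun x => 𝓕 g (-x) := by
      funext x
      rw [← Real.fourierInv_eq_fourier_comp_neg, Real.fourierInv_eq_fourier_neg]
    rw [e6, e5, ← integral_neg_eq_self]
    simp

lemma laguerreFun_sq_le (k : ℕ) :
    ∃ D : ℝ, ∀ y, 0 < y → laguerreFun k y ^ 2 ≤ D * Real.exp (-(1 / 2) * y) := by
  obtain ⟨D, hD0, hL⟩ := exists_laguerrePoly_bound k
  refine ⟨D ^ 2, fun y hy => ?_⟩
  have h1 : |laguerreFun k y| ≤ D * Real.exp (-(1 / 4) * y) := by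
    unfold laguerreFun
    rw [abs_mul, abs_of_nonneg (Real.exp_nonneg _)]
    calc _ ≤ Real.exp (-y / 2) * (D * Real.exp (y / 4)) := by gcongr; exact hL y hy.le
      _ = D * (Real.exp (-y / 2) * Real.exp (y / 4)) := by ring
      _ = _ := by rw [← Real.exp_add]; congr 2; ring
  calc laguerreFun k y ^ 2 = |laguerreFun k y| ^ 2 := (sq_abs _).symm
    _ ≤ (D * Real.exp (-(1 / 4) * y)) ^ 2 := by gcongr
    _ = _ := by rw [mul_pow, ← Real.exp_nat_mul]; congr 2; push_cast; ring

lemma integrableOn_laguerreFun_sq (k : ℕ) :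
    IntegrableOn (fun y => laguerreFun k y ^ 2) (Set.Ioi 0) := by
  obtain ⟨D, hD⟩ := laguerreFun_sq_le k
  refine ((exp_neg_integrableOn_Ioi 0 (b := 1 / 2) (by norm_num)).const_mul D).mono'
    ((continuous_laguerreFun k).pow 2).aestronglyMeasurable ?_
  filter_upwards [ae_restrict_mem measurableSet_Ioi] with y hy
  rw [Real.norm_of_nonneg (sq_nonneg _)]
  exact hD y hy

/-- The integral of `ℓ_k²` over the half-line (used only to show that the wavelet subspaces are
complete). -/
def lagConst (k : ℕ) : ℝ := ∫ y in Set.Ioi (0 : ℝ), laguerreFun k y ^ 2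

lemma lagConst_pos (k : ℕ) : 0 < lagConst k := by
  have h1 : 0 < ∫ y in (0 : ℝ)..1, laguerreFun k y ^ 2 := by
    refine intervalIntegral.integral_pos one_pos ((continuous_laguerreFun k).pow 2).continuousOn
      (fun x _ => sq_nonneg _) ⟨0, by simp, ?_⟩
    have : laguerreFun k 0 = 1 := by
      simp [laguerreFun, laguerrePoly, Finset.sum_range_succ']
    rw [this]; norm_num
  rw [intervalIntegral.integral_of_le zero_le_one] at h1
  refine h1.trans_le (setIntegral_mono_set (integrableOn_laguerreFun_sq k)
    (.of_forall fun x => sq_nonneg _) (.of_forall fun x hx => hx.1))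

/-- The space `L_2(ℝ)`. -/
abbrev L2R := Lp ℂ 2 (volume : Measure ℝ)

/-- The Fourier transform of the dilated wavelet `ψ^{(k)}_v` (used only in proofs). -/
def hat (k : ℕ) (v ξ : ℝ) : ℂ := (√v : ℂ) * waveletHat k (v * ξ)

lemma continuous_hat (k : ℕ) (v : ℝ) : Continuous (hat k v) := by
  have := continuous_waveletHat k
  unfold hat; fun_prop

lemma integrable_hat (k : ℕ) {v : ℝ} (hv : 0 < v) : Integrable (hat k v) :=
  ((integrable_waveletHat k).comp_mul_left' hv.ne').const_mul _

lemma hat_bound (k : ℕ) (v : ℝ) : ∃ C, ∀ ξ, ‖hat k v ξ‖ ≤ C := by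
  obtain ⟨C, hC⟩ := exists_waveletHat_bound' k
  refine ⟨√v * C, fun ξ => ?_⟩
  unfold hat
  rw [norm_mul, Complex.norm_real, Real.norm_of_nonneg (Real.sqrt_nonneg _)]
  gcongr; exact hC _

lemma memLp_top_hat (k : ℕ) (v : ℝ) : MemLp (hat k v) ∞ := by
  obtain ⟨C, hC⟩ := hat_bound k v
  exact memLp_top_of_bound (continuous_hat k v).aestronglyMeasurable C (.of_forall hC)

lemma memLp_hat (k : ℕ) {v : ℝ} (hv : 0 < v) : MemLp (hat k v) 2 := by
  obtain ⟨C, hC⟩ := hat_bound k v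
  rw [memLp_two_iff_integrable_sq_norm (continuous_hat k v).aestronglyMeasurable]
  simp_rw [pow_two]
  exact (integrable_hat k hv).norm.bdd_mul (c := C)
    (continuous_hat k v).norm.aestronglyMeasurable (.of_forall fun x => by simpa using hC x)

lemma conj_hat (k : ℕ) (v ξ : ℝ) : (starRingEnd ℂ) (hat k v ξ) = hat k v ξ := by
  simp [hat, waveletHat_eq]

lemma dilate_eq (k : ℕ) {v : ℝ} (hv : 0 < v) (x : ℝ) :
    dilate v (wavelet k) x = 𝓕⁻ (hat k v) x := by
  unfold dilate wavelet
  rw [Real.fourierInv_eq, Real.fourierInv_eq]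
  have h := Measure.integral_comp_mul_left
    (fun η : ℝ => Real.fourierChar (inner ℝ η (x / v)) • waveletHat k η) v
  have e : ∀ ξ : ℝ, Real.fourierChar (inner ℝ ξ x) • hat k v ξ =
      (√v : ℂ) * (Real.fourierChar (inner ℝ (v * ξ) (x / v)) • waveletHat k (v * ξ)) := by
    intro ξ
    have : inner ℝ (v * ξ) (x / v) = inner ℝ ξ x := by
      simp only [RCLike.inner_apply, conj_trivial]; field_simp
    rw [this, hat, mul_smul_comm]
  simp_rw [e]
  rw [integral_const_mul, h, abs_of_pos (inv_pos.2 hv), Complex.real_smul, ← mul_assoc]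
  congr 1
  rw [← Complex.ofReal_mul]
  congr 1
  rw [← div_eq_mul_inv, Real.sqrt_div_self', one_div]

lemma conj_fourierInv_hat (k : ℕ) (v x : ℝ) :
    (starRingEnd ℂ) (𝓕⁻ (hat k v) x) = 𝓕⁻ (hat k v) (-x) := by
  rw [Real.fourierInv_eq, Real.fourierInv_eq, ← integral_conj]
  refine integral_congr_ae (.of_forall fun ξ => ?_)
  simp only [Circle.smul_def, smul_eq_mul, map_mul, conj_hat, inner_neg_right]
  congr 1
  rw [AddChar.map_neg_eq_inv, Circle.coe_inv_eq_conj]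

lemma transform_eq (k : ℕ) {v : ℝ} (hv : 0 < v) (f : L2R) (u : ℝ) :
    waveletTransform k f (u, v) = 𝓕⁻ (fun ξ => hat k v ξ * (𝓕 f : L2R) ξ) u := by
  set m : ℝ → ℂ := fun ξ => (Real.fourierChar (-(ξ * u)) : ℂ) * hat k v ξ with hm
  have hmc : Continuous m := by
    have := continuous_hat k v
    have h2 : Continuous fun ξ : ℝ => (Real.fourierChar (-(ξ * u))) :=
      Real.continuous_fourierChar.comp (by fun_prop)
    exact (continuous_subtype_val.comp h2).mul this
  have hnorm : ∀ ξ, ‖m ξ‖ = ‖hat k v ξ‖ := fun ξ => by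
    simp only [hm]
    rw [norm_mul, Circle.norm_coe, one_mul]
  have hm1 : Integrable m := (integrable_hat k hv).mono hmc.aestronglyMeasurable
    (.of_forall fun ξ => (hnorm ξ).le)
  have hm2 : MemLp m 2 := (memLp_hat k hv).mono hmc.aestronglyMeasurable
    (.of_forall fun ξ => (hnorm ξ).le)
  have hFm : ∀ t, 𝓕⁻ m t = 𝓕⁻ (hat k v) (t - u) := by
    intro t
    rw [Real.fourierInv_eq, Real.fourierInv_eq]
    refine integral_congr_ae (.of_forall fun ξ => ?_)
    simp only [Circle.smul_def, smul_eq_mul, hm, ← mul_assoc]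
    congr 1
    rw [← Circle.coe_mul, ← AddChar.map_add_eq_mul]
    congr 2
    simp only [RCLike.inner_apply, conj_trivial]; ring
  have h1 : waveletTransform k f (u, v) = inner ℂ (𝓕⁻ (hm2.toLp m) : L2R) f := by
    rw [L2.inner_def, waveletTransform, convolution_def]
    refine integral_congr_ae ?_
    filter_upwards [fourierInv_toLp hm1 hm2] with t ht
    rw [ht, hFm, RCLike.inner_apply, conj_fourierInv_hat, neg_sub, ← dilate_eq k hv]
    simp
  have h2 : inner ℂ (𝓕⁻ (hm2.toLp m) : L2R) f = inner ℂ (hm2.toLp m) (𝓕 f : L2R) := by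
    rw [← Lp.inner_fourier_eq, fourier_fourierInv_eq]
  rw [h1, h2, L2.inner_def, Real.fourierInv_eq]
  refine integral_congr_ae ?_
  filter_upwards [hm2.coeFn_toLp] with ξ hξ
  rw [hξ, RCLike.inner_apply, hm, Circle.smul_def, smul_eq_mul, map_mul, conj_hat,
    AddChar.map_neg_eq_inv, Circle.coe_inv_eq_conj, Complex.conj_conj]
  simp only [RCLike.inner_apply, conj_trivial]
  rw [mul_comm u ξ]; ring

lemma integrable_hat_mul (k : ℕ) {v : ℝ} (hv : 0 < v) (g : L2R) :
    Integrable fun ξ => hat k v ξ * g ξ :=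
  (memLp_hat k hv).integrable_mul (Lp.memLp g)

lemma memLp_hat_mul (k : ℕ) (v : ℝ) (g : L2R) : MemLp (fun ξ => hat k v ξ * g ξ) 2 :=
  (Lp.memLp g).mul (memLp_top_hat k v)

lemma eLpNorm_transform (k : ℕ) {v : ℝ} (hv : 0 < v) (f : L2R) :
    eLpNorm (fun u => waveletTransform k f (u, v)) 2 =
      eLpNorm (fun ξ => hat k v ξ * (𝓕 f : L2R) ξ) 2 := by
  simp_rw [transform_eq k hv]
  have h2 := memLp_hat_mul k v (𝓕 f : L2R)
  rw [← eLpNorm_congr_ae (fourierInv_toLp (integrable_hat_mul k hv _) h2),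
    ← eLpNorm_congr_ae h2.coeFn_toLp]
  have : ‖(𝓕⁻ (h2.toLp _) : L2R)‖ = ‖h2.toLp _‖ :=
    (Lp.fourierTransformₗᵢ ℝ ℂ).symm.norm_map _
  rw [Lp.norm_def, Lp.norm_def, ENNReal.toReal_eq_toReal_iff' (Lp.eLpNorm_ne_top _)
    (Lp.eLpNorm_ne_top _)] at this
  exact this

lemma stronglyMeasurable_transform (k : ℕ) (f : L2R) :
    StronglyMeasurable (waveletTransform k f) := by
  have h1 : StronglyMeasurable (f : ℝ → ℂ) := Lp.stronglyMeasurable f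
  have h2 : Continuous (wavelet k) := continuous_fourierInv (integrable_waveletHat k)
  have h3 : StronglyMeasurable fun q : (ℝ × ℝ) × ℝ =>
      f q.2 * ((((√q.1.2)⁻¹ : ℝ) : ℂ) * wavelet k ((q.1.1 - q.2) / q.1.2)) := by
    refine Measurable.stronglyMeasurable ?_
    have := h1.measurable
    have := h2.measurable
    fun_prop
  exact h3.integral_prod_right'

lemma enorm_hat (k : ℕ) {v ξ : ℝ} (hv : 0 < v) (z : ℂ) :
    ENNReal.ofReal (v ^ 2)⁻¹ * ‖hat k v ξ * z‖ₑ ^ 2 =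
      (Set.Ioi (0 : ℝ)).indicator
        (fun ξ => ENNReal.ofReal (2 * ξ * laguerreFun k (2 * ξ * v) ^ 2) * ‖z‖ₑ ^ 2) ξ := by
  by_cases h : 0 < ξ
  · rw [Set.indicator_of_mem (by exact h), enorm_mul, mul_pow, ← mul_assoc]
    congr 1
    rw [← ofReal_norm, ← ENNReal.ofReal_pow (norm_nonneg _), ← ENNReal.ofReal_mul (by positivity)]
    congr 1
    rw [hat, waveletHat_eq, norm_mul, Complex.norm_real, Complex.norm_real, mul_pow,
      Real.norm_eq_abs, Real.norm_eq_abs, sq_abs, sq_abs, mul_pow, Real.sq_sqrt hv.le,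
      Real.sq_sqrt (by positivity), show 2 * (v * ξ) = 2 * ξ * v by ring]
    field_simp
  · rw [Set.indicator_of_notMem (by exact h), hat,
      waveletHat_of_nonpos k (mul_nonpos_of_nonneg_of_nonpos hv.le (not_lt.1 h))]
    simp

lemma lintegral_lag (k : ℕ) {ξ : ℝ} (h : 0 < ξ) :
    ∫⁻ v in Set.Ioi (0 : ℝ), ENNReal.ofReal (2 * ξ * laguerreFun k (2 * ξ * v) ^ 2) =
      ENNReal.ofReal (lagConst k) := by
  have hb : 0 < 2 * ξ := by positivity
  have hi : IntegrableOn (fun v => laguerreFun k (2 * ξ * v) ^ 2) (Set.Ioi 0) := by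
    have := (integrableOn_Ioi_comp_mul_left_iff (fun y => laguerreFun k y ^ 2) 0 hb).2
      (by rw [mul_zero]; exact integrableOn_laguerreFun_sq k)
    exact this
  rw [← ofReal_integral_eq_lintegral_ofReal (hi.const_mul (2 * ξ)) (.of_forall fun v => by
    positivity)]
  congr 1
  rw [integral_const_mul, integral_comp_mul_left_Ioi (fun y => laguerreFun k y ^ 2) 0 hb,
    mul_zero, smul_eq_mul, ← mul_assoc, mul_inv_cancel₀ hb.ne', one_mul, lagConst]

lemma lintegral_transform (k : ℕ) (f : L2R) :
    ∫⁻ p, ‖waveletTransform k f p‖ₑ ^ 2 ∂affineHaar =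
      ENNReal.ofReal (lagConst k) * ∫⁻ ξ in Set.Ioi (0 : ℝ), ‖(𝓕 f : L2R) ξ‖ₑ ^ 2 := by
  have hm : Measurable fun p => ‖waveletTransform k f p‖ₑ ^ 2 :=
    (stronglyMeasurable_transform k f).enorm.pow_const 2
  set g : L2R := 𝓕 f with hg
  have hgm : Measurable (g : ℝ → ℂ) := (Lp.stronglyMeasurable g).measurable
  rw [affineHaar, lintegral_prod_symm _ hm.aemeasurable,
    lintegral_withDensity_eq_lintegral_mul _ (by fun_prop) hm.lintegral_prod_left']
  have h1 : ∀ v ∈ Set.Ioi (0 : ℝ),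
      ((fun v : ℝ => ENNReal.ofReal (v ^ 2)⁻¹) *
        fun v => ∫⁻ u, ‖waveletTransform k f (u, v)‖ₑ ^ 2) v =
      ∫⁻ ξ, (Set.Ioi (0 : ℝ)).indicator
        (fun ξ => ENNReal.ofReal (2 * ξ * laguerreFun k (2 * ξ * v) ^ 2) * ‖g ξ‖ₑ ^ 2) ξ := by
    intro v hv
    have e := congrArg (fun x => x ^ 2) (eLpNorm_transform k hv f)
    have e2 : ∀ F : ℝ → ℂ, eLpNorm F 2 volume ^ 2 = ∫⁻ x, ‖F x‖ₑ ^ 2 := fun F => by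
      simpa using eLpNorm_nnreal_pow_eq_lintegral (f := F) (μ := volume) (p := 2) (by norm_num)
    simp only [e2] at e
    rw [Pi.mul_apply, e, ← lintegral_const_mul' _ _ (by simp)]
    refine lintegral_congr fun ξ => ?_
    rw [enorm_hat k hv]
    by_cases hξ : ξ ∈ Set.Ioi (0 : ℝ)
    · simp [hξ, hg]
    · simp [hξ]
  rw [setLIntegral_congr_fun measurableSet_Ioi h1]
  simp_rw [lintegral_indicator measurableSet_Ioi]
  rw [lintegral_lintegral_swap, ← lintegral_const_mul _ (by fun_prop)]
  · refine setLIntegral_congr_fun measurableSet_Ioi fun ξ hξ => ?_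
    rw [lintegral_mul_const _ (by
      have := (continuous_laguerreFun k).measurable
      fun_prop), lintegral_lag k hξ]
  · have := (continuous_laguerreFun k).measurable
    refine Measurable.aemeasurable ?_
    unfold Function.uncurry
    fun_prop

lemma sq_eLpNorm {α : Type*} [MeasurableSpace α] (μ : Measure α) (F : α → ℂ) :
    eLpNorm F 2 μ ^ 2 = ∫⁻ x, ‖F x‖ₑ ^ 2 ∂μ := by
  simpa using eLpNorm_nnreal_pow_eq_lintegral (f := F) (μ := μ) (p := 2) (by norm_num)

lemma memLp_transform (k : ℕ) (f : L2R) : MemLp (waveletTransform k f) 2 affineHaar := by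
  refine ⟨(stronglyMeasurable_transform k f).aestronglyMeasurable, ?_⟩
  have h1 : eLpNorm (waveletTransform k f) 2 affineHaar ^ 2 < ∞ := by
    rw [sq_eLpNorm, lintegral_transform]
    refine ENNReal.mul_lt_top ENNReal.ofReal_lt_top ?_
    refine (setLIntegral_le_lintegral _ _).trans_lt ?_
    rw [← sq_eLpNorm]
    exact ENNReal.pow_lt_top (Lp.eLpNorm_lt_top _)
  exact (ENNReal.pow_lt_top_iff.1 h1).resolve_right (by norm_num)

lemma ae_pos : ∀ᵐ p ∂affineHaar, 0 < p.2 := by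
  have h : ∀ᵐ v ∂((volume.restrict (Set.Ioi (0 : ℝ))).withDensity
      fun v => ENNReal.ofReal (v ^ 2)⁻¹), 0 < v :=
    (withDensity_absolutelyContinuous _ _).ae_le (ae_restrict_mem measurableSet_Ioi)
  exact Measure.quasiMeasurePreserving_snd.ae h

lemma integrable_fourierChar_hat_mul (k : ℕ) {v : ℝ} (hv : 0 < v) (g : L2R) (u : ℝ) :
    Integrable fun ξ : ℝ => Real.fourierChar (inner ℝ ξ u) • (hat k v ξ * g ξ) := by
  simpa using (Real.fourierIntegral_convergent_iff (-u)).2 (integrable_hat_mul k hv g)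

lemma transform_add (k : ℕ) (f g : L2R) :
    waveletTransform k ((f + g : L2R) : ℝ → ℂ) =ᵐ[affineHaar]
      fun p => waveletTransform k f p + waveletTransform k g p := by
  filter_upwards [ae_pos] with ⟨u, v⟩ hv
  rw [transform_eq k hv, transform_eq k hv, transform_eq k hv]
  simp only [Real.fourierInv_eq]
  have hi := fun g : L2R => integrable_fourierChar_hat_mul k hv g u
  rw [← integral_add (hi _) (hi _)]
  refine integral_congr_ae ?_
  rw [FourierTransform.fourier_add]
  filter_upwards [Lp.coeFn_add (𝓕 f : L2R) (𝓕 g : L2R)] with ξ hξ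
  rw [hξ, Pi.add_apply, mul_add, smul_add]

lemma transform_smul (k : ℕ) (c : ℂ) (f : L2R) :
    waveletTransform k ((c • f : L2R) : ℝ → ℂ) =ᵐ[affineHaar]
      fun p => c * waveletTransform k f p := by
  filter_upwards [ae_pos] with ⟨u, v⟩ hv
  rw [transform_eq k hv, transform_eq k hv]
  simp only [Real.fourierInv_eq]
  rw [← integral_const_mul]
  refine integral_congr_ae ?_
  rw [FourierTransform.fourier_smul]
  filter_upwards [Lp.coeFn_smul c (𝓕 f : L2R)] with ξ hξ
  rw [hξ, Pi.smul_apply, smul_eq_mul, mul_left_comm, mul_smul_comm]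

lemma fourier_zero' : (𝓕 (0 : L2R) : L2R) = 0 := (Lp.fourierTransformₗᵢ ℝ ℂ).map_zero

/-- The Hardy space `H_2^+(ℝ)`: the `h ∈ L_2(ℝ)` whose (unitary) Fourier transform is supported
in `[0, ∞)`. -/
def hardyPlus : Submodule ℂ (Lp ℂ 2 (volume : Measure ℝ)) where
  carrier := {h | ∀ᵐ ξ : ℝ, ξ < 0 → (𝓕 h : Lp ℂ 2 (volume : Measure ℝ)) ξ = 0}
  zero_mem' := by
    rw [Set.mem_ofPred_eq, fourier_zero']
    filter_upwards [Lp.coeFn_zero ℂ 2 (volume : Measure ℝ)] with ξ h0 _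
    exact h0
  add_mem' {f g} hf hg := by
    simp only [Set.mem_ofPred_eq, FourierTransform.fourier_add] at hf hg ⊢
    filter_upwards [hf, hg, Lp.coeFn_add (𝓕 f : L2R) (𝓕 g : L2R)] with ξ h1 h2 h3 h4
    rw [h3, Pi.add_apply, h1 h4, h2 h4, add_zero]
  smul_mem' c f hf := by
    simp only [Set.mem_ofPred_eq, FourierTransform.fourier_smul] at hf ⊢
    filter_upwards [hf, Lp.coeFn_smul c (𝓕 f : L2R)] with ξ h1 h3 h4
    rw [h3, Pi.smul_apply, h1 h4, smul_zero]

lemma isClosed_hardyPlus : IsClosed (hardyPlus : Set L2R) := by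
  have : (hardyPlus : Set L2R) =
      (fun h => LpToLpRestrictCLM ℝ ℂ ℂ volume 2 (Set.Iio 0) (𝓕 h : L2R)) ⁻¹' {0} := by
    ext h
    have e : h ∈ hardyPlus ↔ ∀ᵐ ξ : ℝ, ξ < 0 → (𝓕 h : L2R) ξ = 0 := Iff.rfl
    rw [SetLike.mem_coe, e, Set.mem_preimage, Set.mem_singleton_iff, Lp.eq_zero_iff_ae_eq_zero]
    have h2 := LpToLpRestrictCLM_coeFn (p := 2) (μ := volume) ℂ (Set.Iio (0 : ℝ)) (𝓕 h : L2R)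
    have h3 : (∀ᵐ ξ : ℝ, ξ < 0 → (𝓕 h : L2R) ξ = 0) ↔
        (𝓕 h : L2R) =ᵐ[volume.restrict (Set.Iio 0)] 0 := by
      rw [Filter.EventuallyEq, ae_restrict_iff' measurableSet_Iio]; rfl
    rw [h3]
    exact ⟨fun h => h2.trans h, fun h => h2.symm.trans h⟩
  rw [this]
  refine isClosed_singleton.preimage ?_
  exact (ContinuousLinearMap.continuous _).comp (Lp.fourierTransformₗᵢ ℝ ℂ).continuous

instance instCompleteSpaceHardyPlus : CompleteSpace hardyPlus := isClosed_hardyPlus.completeSpace_coe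

/-- The wavelet subspace `A^{(k)} = {W_k f : f ∈ H_2^+(ℝ)}` of `L_2(G, dν)`. -/
def waveletSubspace (k : ℕ) : Submodule ℂ (Lp ℂ 2 affineHaar) where
  carrier := {F | ∃ f ∈ hardyPlus, F =ᵐ[affineHaar] waveletTransform k f}
  zero_mem' := by
    refine ⟨0, hardyPlus.zero_mem, ?_⟩
    have h := transform_smul k 0 0
    rw [zero_smul] at h
    filter_upwards [h, Lp.coeFn_zero ℂ 2 affineHaar] with p h1 h2
    rw [h1, h2]; simp
  add_mem' := by
    rintro F G ⟨f, hf, hF⟩ ⟨g, hg, hG⟩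
    refine ⟨f + g, hardyPlus.add_mem hf hg, ?_⟩
    filter_upwards [transform_add k f g, hF, hG, Lp.coeFn_add F G] with p h1 h2 h3 h4
    rw [h4, Pi.add_apply, h2, h3, h1]
  smul_mem' := by
    rintro c F ⟨f, hf, hF⟩
    refine ⟨c • f, hardyPlus.smul_mem c hf, ?_⟩
    filter_upwards [transform_smul k c f, hF, Lp.coeFn_smul c F] with p h1 h2 h4
    rw [h4, Pi.smul_apply, h2, h1, smul_eq_mul]

/-- `W_k` as a linear map on the Hardy space (used only to show completeness of its range). -/
def transformLin (k : ℕ) : hardyPlus →ₗ[ℂ] Lp ℂ 2 affineHaar where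
  toFun f := (memLp_transform k f).toLp
  map_add' f g := by
    rw [← MemLp.toLp_add]
    exact MemLp.toLp_congr _ _ (transform_add k f g)
  map_smul' c f := by
    rw [RingHom.id_apply, ← MemLp.toLp_const_smul]
    exact MemLp.toLp_congr _ _ (transform_smul k c f)

lemma norm_transformLin (k : ℕ) (f : hardyPlus) :
    ‖transformLin k f‖ = √(lagConst k) * ‖f‖ := by
  have h1 : eLpNorm (waveletTransform k f) 2 affineHaar ^ 2 =
      ENNReal.ofReal (lagConst k) * eLpNorm (𝓕 (f : L2R) : L2R) 2 volume ^ 2 := by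
    rw [sq_eLpNorm, lintegral_transform, sq_eLpNorm, ← lintegral_indicator measurableSet_Ioi]
    congr 1
    refine lintegral_congr_ae ?_
    have hf : ∀ᵐ ξ : ℝ, ξ < 0 → (𝓕 (f : L2R) : L2R) ξ = 0 := f.2
    filter_upwards [hf, (Measure.ae_ne volume (0 : ℝ))] with ξ h1 h2
    by_cases h : 0 < ξ
    · rw [Set.indicator_of_mem (by exact h)]
    · rw [Set.indicator_of_notMem (by exact h), h1 (lt_of_le_of_ne (not_lt.1 h) h2)]
      simp
  have h2 := congrArg ENNReal.toReal h1
  rw [ENNReal.toReal_mul, ENNReal.toReal_pow, ENNReal.toReal_pow,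
    ENNReal.toReal_ofReal (lagConst_pos k).le, ← Lp.norm_def, Lp.norm_fourier_eq] at h2
  have h3 : ‖transformLin k f‖ = (eLpNorm (waveletTransform k f) 2 affineHaar).toReal :=
    Lp.norm_toLp _ (memLp_transform k f)
  rw [← h3] at h2
  have h4 : ‖transformLin k f‖ = √(‖transformLin k f‖ ^ 2) := (Real.sqrt_sq (norm_nonneg _)).symm
  rw [h4, h2, Real.sqrt_mul (lagConst_pos k).le, Real.sqrt_sq (norm_nonneg _)]
  rfl

instance instCompleteSpaceWaveletSubspace (k : ℕ) : CompleteSpace (waveletSubspace k) := by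
  have hpos : 0 < √(lagConst k) := Real.sqrt_pos.2 (lagConst_pos k)
  have h1 : AntilipschitzWith (√(lagConst k))⁻¹.toNNReal (transformLin k) := by
    refine AddMonoidHomClass.antilipschitz_of_bound _ fun f => ?_
    rw [norm_transformLin, Real.coe_toNNReal _ (by positivity), ← mul_assoc,
      inv_mul_cancel₀ hpos.ne', one_mul]
  have h2 : UniformContinuous (transformLin k) :=
    AddMonoidHomClass.uniformContinuous_of_bound _ (√(lagConst k))
      fun f => (norm_transformLin k f).le
  have h3 : (waveletSubspace k : Set (Lp ℂ 2 affineHaar)) = Set.range (transformLin k) := by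
    ext F
    constructor
    · rintro ⟨f, hf, hF⟩
      refine ⟨⟨f, hf⟩, Lp.ext ?_⟩
      exact (MemLp.coeFn_toLp (memLp_transform k f)).trans hF.symm
    · rintro ⟨f, rfl⟩
      exact ⟨f, f.2, MemLp.coeFn_toLp (memLp_transform k f)⟩
  have h4 := h1.isComplete_range h2
  rw [← h3] at h4
  exact h4.completeSpace_coe

/-- The wavelet subspace `A^{(k)}` as a Hilbert space in its own right. -/
def WaveletSpace (k : ℕ) : Type := waveletSubspace k

instance instNormedAddCommGroupWaveletSpace (k : ℕ) : NormedAddCommGroup (WaveletSpace k) :=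
  inferInstanceAs (NormedAddCommGroup (waveletSubspace k))

instance instInnerProductSpaceWaveletSpace (k : ℕ) : InnerProductSpace ℂ (WaveletSpace k) :=
  inferInstanceAs (InnerProductSpace ℂ (waveletSubspace k))

instance instCompleteSpaceWaveletSpace (k : ℕ) : CompleteSpace (WaveletSpace k) :=
  inferInstanceAs (CompleteSpace (waveletSubspace k))

/-- The inclusion `A^{(k)} → L_2(G, dν)`. -/
def incl (k : ℕ) : WaveletSpace k →L[ℂ] Lp ℂ 2 affineHaar := (waveletSubspace k).subtypeL

/-- The orthogonal projection `P^{(k)} : L_2(G, dν) → A^{(k)}`. -/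
def proj (k : ℕ) : Lp ℂ 2 affineHaar →L[ℂ] WaveletSpace k :=
  (waveletSubspace k).orthogonalProjectionOnto

/-- The operator `M_a` of pointwise multiplication by `a ∈ L_∞(G)` on `L_2(G, dν)`. -/
def mulOp (a : Lp ℂ ∞ affineHaar) : Lp ℂ 2 affineHaar →L[ℂ] Lp ℂ 2 affineHaar :=
    (ContinuousLinearMap.mul ℂ ℂ).holderL affineHaar ∞ 2 2 a

/-- The Calderón–Toeplitz operator `T_a^{(k)} = P^{(k)} M_a` on `A^{(k)}`. -/
def calderonToeplitz (k : ℕ) (a : Lp ℂ ∞ affineHaar) : WaveletSpace k →L[ℂ] WaveletSpace k :=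
  proj k ∘L mulOp a ∘L incl k

/-- The C*-algebra `T_k(𝒜)` generated by the operators `T_a^{(k)}`, `a ∈ 𝒜`: the norm closure of the
*-algebra they generate in the bounded operators on `A^{(k)}`. -/
def toeplitzAlgebra (k : ℕ) (𝒜 : Set (Lp ℂ ∞ affineHaar)) :
    NonUnitalStarSubalgebra ℂ (WaveletSpace k →L[ℂ] WaveletSpace k) :=
  (NonUnitalStarAlgebra.adjoin ℂ (calderonToeplitz k '' 𝒜)).topologicalClosure

lemma memLp_verticalSymbol {a : ℝ → ℂ} (ha : MemLp a ∞ (volume.restrict (Set.Ioi 0))) :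
    MemLp (fun p : ℝ × ℝ => a p.2) ∞ affineHaar := by
  have hq : Measure.QuasiMeasurePreserving Prod.snd affineHaar (volume.restrict (Set.Ioi (0 : ℝ))) :=
    Measure.quasiMeasurePreserving_snd.mono_right (withDensity_absolutelyContinuous _ _)
  refine memLp_top_of_bound (ha.1.comp_quasiMeasurePreserving hq)
    (eLpNorm a ∞ (volume.restrict (Set.Ioi 0))).toReal ?_
  refine hq.ae (p := fun v => ‖a v‖ ≤ _) ?_
  filter_upwards [ae_le_eLpNormEssSup (f := a) (μ := volume.restrict (Set.Ioi 0))] with v hv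
  rw [← toReal_enorm, eLpNorm_exponent_top]
  refine ENNReal.toReal_mono ?_ hv
  have := ha.2.ne
  rwa [eLpNorm_exponent_top] at this

/-- The symbol `(u, v) ↦ a(v)` on `G`, for `a ∈ L_∞(ℝ_+)`. -/
def verticalSymbol (a : ℝ → ℂ) (ha : MemLp a ∞ (volume.restrict (Set.Ioi 0))) :
    Lp ℂ ∞ affineHaar := (memLp_verticalSymbol ha).toLp

/-- The algebra `𝒜_∞` of all bounded symbols on `G` that depend only on `v`. -/
def verticalSymbols : Set (Lp ℂ ∞ affineHaar) :=
  {b | ∃ (a : ℝ → ℂ) (ha : MemLp a ∞ (volume.restrict (Set.Ioi 0))), b = verticalSymbol a ha}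

/-- The function `γ_{a,k}(ξ) = ∫_0^∞ a(v / (2ξ)) ℓ_k(v)² dv`. -/
def gammaFun (k : ℕ) (a : ℝ → ℂ) (ξ : ℝ) : ℂ :=
  ∫ v in Set.Ioi (0 : ℝ), a (v / (2 * ξ)) * ((laguerreFun k v ^ 2 : ℝ) : ℂ)

lemma calderonToeplitz_mem (k : ℕ) {𝒜 : Set (Lp ℂ ∞ affineHaar)} {a} (ha : a ∈ 𝒜) :
    calderonToeplitz k a ∈ toeplitzAlgebra k 𝒜 :=
  NonUnitalStarSubalgebra.le_topologicalClosure _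
    (NonUnitalStarAlgebra.subset_adjoin ℂ _ ⟨a, ha, rfl⟩)

end

end CalderonToeplitz

open CalderonToeplitz

namespace CalderonToeplitz

/-! The map `V : W_k f ↦ 𝓕 f` identifies `A^{(k)}` unitarily with `L_2(ℝ_+)`, and it turns every
operator with a vertical symbol into multiplication by `γ_{a,k}`. It is isometric because `∫ ℓ_k² =
1` (`lagConst_eq_one`).

To diagonalise `T_a`, compare quadratic forms. Plancherel on each slice `v = const` writes the slice
norm of `W_k f` as an integral of `|𝓕 f|²` against `2ξ ℓ_k(2ξv)²`. Weighting by `a(v)` and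
exchanging the integrals produces `∫ γ_{a,k} |𝓕 f|²` (`integral_symbol_mul_norm_sq_transform`). Over
`ℂ` the quadratic form determines the operator, which gives `calderonToeplitz_verticalSymbol`.

The rest is C*-algebra. Sending `φ ∈ C_b(ℝ_+)` to multiplication by `φ`, carried back to `A^{(k)}`,
is an injective *-homomorphism (`multiplierHom`), hence isometric with closed range. That range
contains the generators, so it contains the whole Toeplitz algebra, which is therefore commutative;
`τ` is the inverse of `multiplierHom` there. Uniqueness holds because a continuous *-homomorphism is
determined by its values on generators. -/

/-! ### Normalisation of the Laguerre functions. -/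

lemma integral_exp_neg_mul_pow (n : ℕ) :
    ∫ y in Set.Ioi (0 : ℝ), Real.exp (-y) * y ^ n = n.factorial := by
  rw [← Real.Gamma_nat_eq_factorial, Real.Gamma_eq_integral (by positivity)]
  simp

lemma integrableOn_exp_neg_mul_pow (n : ℕ) :
    IntegrableOn (fun y : ℝ => Real.exp (-y) * y ^ n) (Set.Ioi 0) := by
  have := Real.GammaIntegral_convergent (s := n + 1) (by positivity)
  simpa using this

lemma laguerreFun_sq_eq_sum (k : ℕ) (y : ℝ) :
    laguerreFun k y ^ 2 = ∑ i ∈ Finset.range (k + 1), ∑ j ∈ Finset.range (k + 1),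
      ((-1) ^ i * (k.choose i : ℝ) / i.factorial * ((-1) ^ j * (k.choose j : ℝ) / j.factorial)) *
        (Real.exp (-y) * y ^ (i + j)) := by
  have h : Real.exp (-y) = Real.exp (-y / 2) * Real.exp (-y / 2) := by
    rw [← Real.exp_add]; congr 1; ring
  rw [laguerreFun, laguerrePoly, h, pow_two, mul_mul_mul_comm, Finset.sum_mul_sum, Finset.mul_sum]
  refine Finset.sum_congr rfl fun i hi => ?_
  rw [Finset.mul_sum]
  refine Finset.sum_congr rfl fun j hj => ?_
  rw [Nat.choose_symm (Finset.mem_range_succ_iff.1 hi),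
    Nat.choose_symm (Finset.mem_range_succ_iff.1 hj)]
  ring

/-- Up to the sign `(-1)^k` this is the `k`-th forward difference of `x ↦ x.choose i` at `x = i`.
The function is a polynomial of degree `i` whose `i`-th difference is `1`, so any further difference
vanishes. -/
lemma sum_neg_one_pow_choose_mul_choose_add {i k : ℕ} (hi : i ≤ k) :
    ∑ j ∈ Finset.range (k + 1), (-1 : ℤ) ^ j * k.choose j * (i + j).choose i =
      if i = k then (-1) ^ k else 0 := by
  have h1 : (fwdDiff 1)^[k] (fun x ↦ x.choose i : ℕ → ℤ) i = if i = k then 1 else 0 := by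
    have h0 : (fwdDiff 1)^[i] (fun x ↦ x.choose i : ℕ → ℤ) = fun _ => 1 := by
      simpa using fwdDiff_iter_choose 0 i
    obtain ⟨m, rfl⟩ := Nat.exists_eq_add_of_le' hi
    rw [Function.iterate_add_apply, h0]
    cases m with
    | zero => simp
    | succ m =>
      rw [Function.iterate_succ_apply, fwdDiff_const, if_neg (by omega), fwdDiff_iter_eq_sum_shift]
      simp
  have h2 : (if i = k then (-1) ^ k else 0 : ℤ) = (-1) ^ k * if i = k then 1 else 0 := by simp
  rw [h2, ← h1, fwdDiff_iter_eq_sum_shift, Finset.mul_sum]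
  refine Finset.sum_congr rfl fun j hj => ?_
  obtain ⟨m, rfl⟩ := Nat.exists_eq_add_of_le' (Finset.mem_range_succ_iff.1 hj)
  -- Here `m = k - j`: the difference formula carries the sign `(-1)^(k-j)`, which the prefactor
  -- `(-1)^k` turns into `(-1)^j`.
  have h3 : (-1 : ℤ) ^ (m + j) * (-1) ^ m = (-1) ^ j := by
    rw [pow_add, mul_right_comm, ← mul_pow]; simp
  rw [Nat.add_sub_cancel, smul_eq_mul, smul_eq_mul, mul_one, ← mul_assoc, ← mul_assoc, h3]

/-- Integrating the expanded square termwise gives factorials `(i+j)!`, and `(i+j)!/(i! j!)` is a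
binomial coefficient. The alternating sum over `j` then kills every `i < k`, and `i = k` contributes
`(-1)^k (-1)^k = 1`. -/
lemma lagConst_eq_one (k : ℕ) : lagConst k = 1 := by
  have hint := integrableOn_exp_neg_mul_pow
  have h1 : lagConst k = ∑ i ∈ Finset.range (k + 1), ∑ j ∈ Finset.range (k + 1),
      ((-1) ^ i * (k.choose i : ℝ) / i.factorial * ((-1) ^ j * (k.choose j : ℝ) / j.factorial)) *
        (i + j).factorial := by
    rw [lagConst]
    simp_rw [laguerreFun_sq_eq_sum]
    rw [integral_finsetSum _ fun i _ => integrable_finsetSum _ fun j _ => (hint _).const_mul _]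
    refine Finset.sum_congr rfl fun i _ => ?_
    rw [integral_finsetSum _ fun j _ => (hint _).const_mul _]
    refine Finset.sum_congr rfl fun j _ => ?_
    rw [integral_const_mul, integral_exp_neg_mul_pow]
  have h2 : ∀ i ∈ Finset.range (k + 1), ∑ j ∈ Finset.range (k + 1),
      ((-1) ^ i * (k.choose i : ℝ) / i.factorial * ((-1) ^ j * (k.choose j : ℝ) / j.factorial)) *
        (i + j).factorial = (-1) ^ i * (k.choose i : ℝ) * if i = k then (-1) ^ k else 0 := by
    intro i hi
    have h3 := congrArg (fun n : ℤ => (n : ℝ))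
      (sum_neg_one_pow_choose_mul_choose_add (Finset.mem_range_succ_iff.1 hi))
    push_cast at h3
    rw [← h3, Finset.mul_sum]
    refine Finset.sum_congr rfl fun j _ => ?_
    rw [Nat.cast_add_choose]
    have := i.factorial_ne_zero
    have := j.factorial_ne_zero
    field_simp
  rw [h1, Finset.sum_congr rfl h2]
  simp [← mul_pow]

/-! ### The functions `γ_{a,k}`: convergence, boundedness, continuity. -/

lemma ae_norm_le_of_memLp_top {α : Type*} [MeasurableSpace α] {μ : Measure α} {a : α → ℂ}
    (ha : MemLp a ∞ μ) : ∀ᵐ v ∂μ, ‖a v‖ ≤ (eLpNorm a ∞ μ).toReal := by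
  filter_upwards [ae_le_eLpNormEssSup (f := a) (μ := μ)] with v hv
  rw [← toReal_enorm]
  exact ENNReal.toReal_mono ha.2.ne (by rwa [eLpNorm_exponent_top])

lemma integrableOn_laguerreFun_sq_comp_mul (k : ℕ) {b : ℝ} (hb : 0 < b) :
    IntegrableOn (fun v => laguerreFun k (b * v) ^ 2) (Set.Ioi 0) :=
  (integrableOn_Ioi_comp_mul_left_iff (fun y => laguerreFun k y ^ 2) 0 hb).2
    (by rw [mul_zero]; exact integrableOn_laguerreFun_sq k)

lemma integrableOn_mul_laguerreFun_sq (k : ℕ) {a : ℝ → ℂ}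
    (ha : MemLp a ∞ (volume.restrict (Set.Ioi 0))) {b : ℝ} (hb : 0 < b) :
    IntegrableOn (fun v => a v * ((laguerreFun k (b * v) ^ 2 : ℝ) : ℂ)) (Set.Ioi 0) :=
  (integrableOn_laguerreFun_sq_comp_mul k hb).ofReal.bdd_mul ha.1 (ae_norm_le_of_memLp_top ha)

lemma integrableOn_gamma (k : ℕ) {a : ℝ → ℂ} (ha : MemLp a ∞ (volume.restrict (Set.Ioi 0)))
    {ξ : ℝ} (hξ : 0 < ξ) :
    IntegrableOn (fun v => a (v / (2 * ξ)) * ((laguerreFun k v ^ 2 : ℝ) : ℂ)) (Set.Ioi 0) := by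
  have hb : 0 < 2 * ξ := by positivity
  rw [← mul_zero (2 * ξ), ← integrableOn_Ioi_comp_mul_left_iff _ 0 hb]
  simpa [hξ.ne', mul_div_cancel_left₀ _ hb.ne'] using integrableOn_mul_laguerreFun_sq k ha hb

/-- The substitution moves `ξ` from the symbol, which is only measurable, onto the continuous
Laguerre factor. In this form continuity in `ξ` is visible, and the kernel is the one that
Plancherel produces on slices. -/
lemma gammaFun_eq (k : ℕ) (a : ℝ → ℂ) {ξ : ℝ} (hξ : 0 < ξ) :
    gammaFun k a ξ =
      ∫ v in Set.Ioi (0 : ℝ), a v * ((2 * ξ * laguerreFun k (2 * ξ * v) ^ 2 : ℝ) : ℂ) := by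
  have hb : 0 < 2 * ξ := by positivity
  have h := integral_comp_mul_left_Ioi
    (fun v => a (v / (2 * ξ)) * ((laguerreFun k v ^ 2 : ℝ) : ℂ)) 0 hb
  simp only [mul_zero, mul_div_cancel_left₀ _ hb.ne'] at h
  have h2 : ∀ v : ℝ, a v * ((2 * ξ * laguerreFun k (2 * ξ * v) ^ 2 : ℝ) : ℂ) =
      ((2 * ξ : ℝ) : ℂ) * (a v * ((laguerreFun k (2 * ξ * v) ^ 2 : ℝ) : ℂ)) := fun v => by
    push_cast; ring
  simp_rw [h2]
  rw [integral_const_mul, h, ← Complex.real_smul, smul_smul, mul_inv_cancel₀ hb.ne', one_smul,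
    gammaFun]

/-- For each `ξ` the kernel `2ξ ℓ_k(2ξv)²` is a probability density in `v`, so `γ_{a,k}(ξ)` is an
average of `a`. -/
lemma norm_gammaFun_le (k : ℕ) {a : ℝ → ℂ} (ha : MemLp a ∞ (volume.restrict (Set.Ioi 0)))
    {ξ : ℝ} (hξ : 0 < ξ) :
    ‖gammaFun k a ξ‖ ≤ (eLpNorm a ∞ (volume.restrict (Set.Ioi 0))).toReal := by
  have hb : 0 < 2 * ξ := by positivity
  rw [gammaFun_eq k a hξ]
  refine (norm_integral_le_of_norm_le (((integrableOn_laguerreFun_sq_comp_mul k hb).const_mul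
    (2 * ξ)).const_mul (eLpNorm a ∞ (volume.restrict (Set.Ioi 0))).toReal) ?_).trans_eq ?_
  · filter_upwards [ae_norm_le_of_memLp_top ha] with v hv
    rw [norm_mul, Complex.norm_real, Real.norm_of_nonneg (by positivity)]
    gcongr
  · rw [integral_const_mul, integral_const_mul,
      integral_comp_mul_left_Ioi (fun y => laguerreFun k y ^ 2) 0 hb, mul_zero, smul_eq_mul,
      ← mul_assoc (2 * ξ), mul_inv_cancel₀ hb.ne', one_mul, ← lagConst, lagConst_eq_one, mul_one]

lemma continuousOn_gammaFun (k : ℕ) {a : ℝ → ℂ} (ha : MemLp a ∞ (volume.restrict (Set.Ioi 0))) :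
    ContinuousOn (gammaFun k a) (Set.Ioi 0) := by
  refine ContinuousOn.congr (f := fun ξ => ∫ v in Set.Ioi (0 : ℝ),
    a v * ((2 * ξ * laguerreFun k (2 * ξ * v) ^ 2 : ℝ) : ℂ)) ?_ fun ξ hξ => gammaFun_eq k a hξ
  intro ξ₀ hξ₀
  have hξ₀ : 0 < ξ₀ := hξ₀
  refine ContinuousAt.continuousWithinAt ?_
  obtain ⟨D, hD⟩ := laguerreFun_sq_le k
  have hc := continuous_laguerreFun k
  -- On this interval `2ξ ≤ 4ξ₀`, and the decay `ℓ_k(y)² ≤ D e^{-y/2}` at `y = 2ξv` gives `e^{-ξv} ≤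
  -- e^{-ξ₀v/2}`: one integrable majorant for all `ξ`. The sign of `D` is not known, hence `|D|`.
  have hnhds : Set.Ioo (ξ₀ / 2) (2 * ξ₀) ∈ nhds ξ₀ := Ioo_mem_nhds (by linarith) (by linarith)
  refine continuousAt_of_dominated (bound := fun v =>
    (eLpNorm a ∞ (volume.restrict (Set.Ioi 0))).toReal *
      (4 * ξ₀ * (|D| * Real.exp (-(ξ₀ / 2) * v)))) ?_ ?_ ?_ ?_
  · refine .of_forall fun ξ => ha.1.mul ?_
    exact Continuous.aestronglyMeasurable (by fun_prop)
  · filter_upwards [hnhds] with ξ hξ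
    filter_upwards [ae_norm_le_of_memLp_top ha, ae_restrict_mem measurableSet_Ioi] with v hv hv0
    have hv0 : 0 < v := hv0
    have hξ0 : 0 < ξ := by linarith [hξ.1]
    rw [norm_mul, Complex.norm_real, Real.norm_of_nonneg (by positivity)]
    have h1 : laguerreFun k (2 * ξ * v) ^ 2 ≤ |D| * Real.exp (-(ξ₀ / 2) * v) := by
      have h3 : -(1 / 2) * (2 * ξ * v) ≤ -(ξ₀ / 2) * v := by nlinarith [hξ.1]
      exact (hD (2 * ξ * v) (by positivity)).trans (mul_le_mul (le_abs_self D)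
        (Real.exp_le_exp.2 h3) (Real.exp_pos _).le (abs_nonneg D))
    have h2 : 2 * ξ ≤ 4 * ξ₀ := by linarith [hξ.2]
    gcongr
  · exact (((exp_neg_integrableOn_Ioi 0 (b := ξ₀ / 2) (by positivity)).const_mul |D|).const_mul
      _).const_mul _
  · refine .of_forall fun v => ?_
    exact Continuous.continuousAt (by fun_prop)

/-- The function `γ_{a,k}` as an element of `C_b(ℝ_+)`. -/
noncomputable def gammaBCF (k : ℕ) {a : ℝ → ℂ} (ha : MemLp a ∞ (volume.restrict (Set.Ioi 0))) :
    BoundedContinuousFunction (Set.Ioi (0 : ℝ)) ℂ :=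
  .ofNormedAddCommGroup (fun ξ => gammaFun k a ξ)
    (continuousOn_iff_continuous_domRestrict.1 (continuousOn_gammaFun k ha)) _
    fun ξ => norm_gammaFun_le k ha ξ.2

/-! ### The unitary model of the wavelet subspace on `L_2(ℝ_+)`. -/

noncomputable section

/-- The wavelet transform as an isometry of the Hardy space into the wavelet subspace. -/
def transformIsometry (k : ℕ) : hardyPlus →ₗᵢ[ℂ] WaveletSpace k where
  toLinearMap := (transformLin k).codRestrict (waveletSubspace k)
    fun f => ⟨f, f.2, (memLp_transform k f).coeFn_toLp⟩
  norm_map' f := by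
    have h := norm_transformLin k f
    rw [lagConst_eq_one, Real.sqrt_one, one_mul] at h
    exact h

lemma incl_transformIsometry (k : ℕ) (f : hardyPlus) :
    (incl k (transformIsometry k f) : ℝ × ℝ → ℂ) =ᵐ[affineHaar] waveletTransform k f :=
  (memLp_transform k f).coeFn_toLp

lemma transformIsometry_surjective (k : ℕ) : Function.Surjective (transformIsometry k) := by
  rintro ⟨F, f, hf, hF⟩
  exact ⟨⟨f, hf⟩, Subtype.ext (Lp.ext ((memLp_transform k f).coeFn_toLp.trans hF.symm))⟩

/-- The isometry `W_k f ↦ 𝓕 f` of the wavelet subspace into `L_2(ℝ)`. -/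
def spectralIsometry (k : ℕ) : WaveletSpace k →ₗᵢ[ℂ] L2R :=
  ((Lp.fourierTransformₗᵢ ℝ ℂ).toLinearIsometry.comp hardyPlus.subtypeₗᵢ).comp
    (LinearIsometryEquiv.ofSurjective (transformIsometry k)
      (transformIsometry_surjective k)).symm.toLinearIsometry

lemma spectralIsometry_transformIsometry (k : ℕ) (f : hardyPlus) :
    spectralIsometry k (transformIsometry k f) = 𝓕 (f : L2R) := by
  have h : (LinearIsometryEquiv.ofSurjective (transformIsometry k)
      (transformIsometry_surjective k)).symm (transformIsometry k f) = f :=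
    LinearIsometryEquiv.symm_apply_apply _ f
  exact congrArg (fun f : hardyPlus => (𝓕 (f : L2R) : L2R)) h

lemma mem_range_spectralIsometry (k : ℕ) {g : L2R} (hg : ∀ᵐ ξ : ℝ, ξ < 0 → g ξ = 0) :
    ∃ F, spectralIsometry k F = g := by
  have h : (𝓕 (𝓕⁻ g : L2R) : L2R) = g := fourier_fourierInv_eq g
  refine ⟨transformIsometry k ⟨(𝓕⁻ g : L2R), ?_⟩, ?_⟩
  · change ∀ᵐ ξ : ℝ, ξ < 0 → (𝓕 (𝓕⁻ g : L2R) : L2R) ξ = 0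
    rwa [h]
  · rw [spectralIsometry_transformIsometry]
    exact h

/-- An isometry satisfies `V V* = 1` on its range, and the range of `V` contains every function
vanishing on the negative half-line. -/
lemma spectralIsometry_adjoint_apply (k : ℕ) {g : L2R} (hg : ∀ᵐ ξ : ℝ, ξ < 0 → g ξ = 0) :
    spectralIsometry k ((spectralIsometry k).toContinuousLinearMap.adjoint g) = g := by
  obtain ⟨F, rfl⟩ := mem_range_spectralIsometry k hg
  congr 1
  refine ext_inner_left ℂ fun G => ?_
  rw [ContinuousLinearMap.adjoint_inner_right]
  exact (spectralIsometry k).inner_map_map G F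

/-! ### Multiplication operators and the embedding of `C_b(ℝ_+)`. -/

/-- The extension by zero to `ℝ` of a bounded continuous function on `ℝ_+`. -/
def zeroExtend (φ : BoundedContinuousFunction (Set.Ioi (0 : ℝ)) ℂ) (x : ℝ) : ℂ :=
  if h : 0 < x then φ ⟨x, h⟩ else 0

lemma measurable_zeroExtend (φ : BoundedContinuousFunction (Set.Ioi (0 : ℝ)) ℂ) :
    Measurable (zeroExtend φ) :=
  Measurable.dite (s := Set.Ioi (0 : ℝ)) φ.continuous.measurable measurable_const measurableSet_Ioi

lemma memLp_zeroExtend (φ : BoundedContinuousFunction (Set.Ioi (0 : ℝ)) ℂ) :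
    MemLp (zeroExtend φ) ∞ volume := by
  refine memLp_top_of_bound (measurable_zeroExtend φ).aestronglyMeasurable ‖φ‖ (.of_forall fun x => ?_)
  unfold zeroExtend
  split_ifs with h
  · exact φ.norm_coe_le_norm _
  · simp

/-- Multiplication on `L_2(ℝ)` by a bounded continuous function on `ℝ_+`, extended by zero. -/
def mulL2 (φ : BoundedContinuousFunction (Set.Ioi (0 : ℝ)) ℂ) : L2R →L[ℂ] L2R :=
  (ContinuousLinearMap.mul ℂ ℂ).holderL volume ∞ 2 2 (memLp_zeroExtend φ).toLp

lemma mulL2_apply (φ : BoundedContinuousFunction (Set.Ioi (0 : ℝ)) ℂ) (g : L2R) :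
    mulL2 φ g =ᵐ[volume] fun ξ => zeroExtend φ ξ * g ξ := by
  filter_upwards [(ContinuousLinearMap.mul ℂ ℂ).coeFn_holder (r := 2)
    (memLp_zeroExtend φ).toLp g, (memLp_zeroExtend φ).coeFn_toLp] with ξ h1 h2
  rw [h2] at h1
  exact h1

lemma mulL2_apply_neg (φ : BoundedContinuousFunction (Set.Ioi (0 : ℝ)) ℂ) (g : L2R) :
    ∀ᵐ ξ : ℝ, ξ < 0 → mulL2 φ g ξ = 0 := by
  filter_upwards [mulL2_apply φ g] with ξ h1 h2
  rw [h1, zeroExtend, dif_neg h2.not_gt, zero_mul]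

/-- The operator on the wavelet subspace which is unitarily equivalent to multiplication by `φ`
on `L_2(ℝ_+)`. -/
def multiplier (k : ℕ) (φ : BoundedContinuousFunction (Set.Ioi (0 : ℝ)) ℂ) :
    WaveletSpace k →L[ℂ] WaveletSpace k :=
  (spectralIsometry k).toContinuousLinearMap.adjoint ∘L mulL2 φ ∘L
    (spectralIsometry k).toContinuousLinearMap

/-- The zero extension keeps the product inside the range of `V`, so the adjoint loses nothing. As
`V` is injective, linearity and multiplicativity in `φ` become pointwise identities. -/
lemma spectralIsometry_multiplier (k : ℕ) (φ : BoundedContinuousFunction (Set.Ioi (0 : ℝ)) ℂ)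
    (F : WaveletSpace k) :
    spectralIsometry k (multiplier k φ F) = mulL2 φ (spectralIsometry k F) :=
  spectralIsometry_adjoint_apply k (mulL2_apply_neg φ _)

lemma inner_multiplier (k : ℕ) (φ : BoundedContinuousFunction (Set.Ioi (0 : ℝ)) ℂ)
    (F G : WaveletSpace k) :
    inner ℂ F (multiplier k φ G) = ∫ ξ, starRingEnd ℂ (spectralIsometry k F ξ) *
      (zeroExtend φ ξ * spectralIsometry k G ξ) := by
  rw [← (spectralIsometry k).inner_map_map, spectralIsometry_multiplier, L2.inner_def]
  refine integral_congr_ae ?_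
  filter_upwards [mulL2_apply φ (spectralIsometry k G)] with ξ h
  rw [h, RCLike.inner_apply, mul_comm]

/-- The map `φ ↦ multiplier k φ` as a homomorphism of *-algebras. -/
def multiplierHom (k : ℕ) : BoundedContinuousFunction (Set.Ioi (0 : ℝ)) ℂ →⋆ₙₐ[ℂ]
    (WaveletSpace k →L[ℂ] WaveletSpace k) where
  toFun := multiplier k
  map_smul' c φ := by
    refine ContinuousLinearMap.ext fun F => (spectralIsometry k).injective ?_
    rw [smul_apply, map_smul, spectralIsometry_multiplier,
      spectralIsometry_multiplier]
    refine Lp.ext ?_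
    filter_upwards [mulL2_apply (c • φ) (spectralIsometry k F), mulL2_apply φ (spectralIsometry k F),
      Lp.coeFn_smul c (mulL2 φ (spectralIsometry k F))] with ξ h1 h2 h3
    simp only [MonoidHom.id_apply]
    rw [h1, h3, Pi.smul_apply, h2, zeroExtend, zeroExtend]
    split_ifs <;> simp [mul_assoc]
  map_zero' := by
    refine ContinuousLinearMap.ext fun F => (spectralIsometry k).injective ?_
    rw [zero_apply, map_zero, spectralIsometry_multiplier]
    refine Lp.ext ?_
    filter_upwards [mulL2_apply 0 (spectralIsometry k F), Lp.coeFn_zero ℂ 2 volume] with ξ h1 h2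
    rw [h1, h2, zeroExtend]
    split_ifs <;> simp
  map_add' φ ψ := by
    refine ContinuousLinearMap.ext fun F => (spectralIsometry k).injective ?_
    rw [add_apply, map_add, spectralIsometry_multiplier,
      spectralIsometry_multiplier, spectralIsometry_multiplier]
    refine Lp.ext ?_
    filter_upwards [mulL2_apply (φ + ψ) (spectralIsometry k F),
      mulL2_apply φ (spectralIsometry k F), mulL2_apply ψ (spectralIsometry k F),
      Lp.coeFn_add (mulL2 φ (spectralIsometry k F)) (mulL2 ψ (spectralIsometry k F))]
      with ξ h1 h2 h3 h4
    rw [h1, h4, Pi.add_apply, h2, h3, zeroExtend, zeroExtend, zeroExtend]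
    split_ifs <;> simp [add_mul]
  map_mul' φ ψ := by
    refine ContinuousLinearMap.ext fun F => (spectralIsometry k).injective ?_
    rw [mul_apply_eq_comp, spectralIsometry_multiplier,
      spectralIsometry_multiplier, spectralIsometry_multiplier]
    refine Lp.ext ?_
    filter_upwards [mulL2_apply (φ * ψ) (spectralIsometry k F),
      mulL2_apply φ (mulL2 ψ (spectralIsometry k F)), mulL2_apply ψ (spectralIsometry k F)]
      with ξ h1 h2 h3
    rw [h1, h2, h3, zeroExtend, zeroExtend, zeroExtend]
    split_ifs <;> simp [mul_assoc]
  map_star' φ := by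
    refine ContinuousLinearMap.ext fun F => ext_inner_left ℂ fun G => ?_
    -- Moving the adjoint across and swapping the arguments by conjugation makes both sides
    -- integrals of the form `inner_multiplier`, which agree pointwise.
    rw [ContinuousLinearMap.star_eq_adjoint, ContinuousLinearMap.adjoint_inner_right,
      ← inner_conj_symm (multiplier k φ G) F, inner_multiplier, inner_multiplier, ← integral_conj]
    refine integral_congr_ae (.of_forall fun ξ => ?_)
    simp only [map_mul, Complex.conj_conj, zeroExtend]
    split_ifs
    · simp [mul_left_comm, mul_comm]
    · simp

/-- One test function suffices: the index `0` wavelet, whatever `k` is, because `L_0 = 1` makes its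
transform `√(2ξ) e^{-ξ}` free of zeros on `ℝ_+`. A multiplier killing it vanishes a.e., hence
everywhere by continuity. -/
lemma multiplierHom_injective (k : ℕ) : Function.Injective (multiplierHom k) := by
  refine (injective_iff_map_eq_zero _).2 fun φ hφ => ?_
  have hφ : multiplier k φ = 0 := hφ
  have hm := memLp_waveletHat 0
  obtain ⟨F, hF⟩ := mem_range_spectralIsometry k (g := hm.toLp) (by
    filter_upwards [hm.coeFn_toLp] with ξ h1 h2
    rw [h1, waveletHat_of_nonpos 0 h2.le])
  have h0 : mulL2 φ hm.toLp = 0 := by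
    rw [← hF, ← spectralIsometry_multiplier, hφ]
    simp
  have h1 : ∀ᵐ ξ : ℝ, 0 < ξ → zeroExtend φ ξ = 0 := by
    have h2 := mulL2_apply φ hm.toLp
    rw [h0] at h2
    filter_upwards [h2, hm.coeFn_toLp, Lp.coeFn_zero ℂ 2 volume] with ξ h2 h3 h4 h5
    rw [h4, h3, waveletHat_eq] at h2
    refine (mul_eq_zero.1 h2.symm).resolve_right (Complex.ofReal_ne_zero.2 (ne_of_gt ?_))
    have h6 : laguerrePoly 0 (2 * ξ) = 1 := by simp [laguerrePoly]
    rw [laguerreFun, h6]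
    positivity
  have h3 : Set.EqOn (zeroExtend φ) 0 (Set.Ioi 0) := by
    refine Measure.eqOn_open_of_ae_eq (μ := volume) ?_ isOpen_Ioi ?_ continuousOn_const
    · exact (ae_restrict_iff' measurableSet_Ioi).2 h1
    · rw [continuousOn_iff_continuous_domRestrict]
      convert φ.continuous using 1
      ext x
      simp [zeroExtend, x.2.out]
  ext x
  simpa [zeroExtend, x.2.out] using h3 x.2

/-- Injective *-homomorphisms of C*-algebras preserve the norm. -/
lemma multiplierHom_isometry (k : ℕ) : Isometry (multiplierHom k) :=
  NonUnitalStarAlgHom.isometry _ (multiplierHom_injective k)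

end

/-! ### The quadratic form of a vertical symbol. -/

lemma integral_norm_sq_eq_toReal {α : Type*} [MeasurableSpace α] {μ : Measure α} {F : α → ℂ}
    (hF : AEStronglyMeasurable F μ) : ∫ x, ‖F x‖ ^ 2 ∂μ = (eLpNorm F 2 μ ^ 2).toReal := by
  rw [sq_eLpNorm, integral_eq_lintegral_of_nonneg_ae (.of_forall fun x => sq_nonneg _)
    (hF.norm.pow 2)]
  congr 1
  refine lintegral_congr fun x => ?_
  rw [ENNReal.ofReal_pow (norm_nonneg _), ofReal_norm]

/-- The squared dilated wavelet carries the factor `v · 2vξ`, which the Haar density `v⁻²` reduces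
to `2ξ`. -/
lemma norm_hat_mul_sq (k : ℕ) {v ξ : ℝ} (hv : 0 < v) (z : ℂ) :
    (v ^ 2)⁻¹ * ‖hat k v ξ * z‖ ^ 2 = (Set.Ioi (0 : ℝ)).indicator
      (fun ξ => 2 * ξ * laguerreFun k (2 * ξ * v) ^ 2 * ‖z‖ ^ 2) ξ := by
  have h := congrArg ENNReal.toReal (enorm_hat k (ξ := ξ) hv z)
  rw [ENNReal.toReal_mul, ENNReal.toReal_ofReal (by positivity), ENNReal.toReal_pow,
    toReal_enorm] at h
  rw [h]
  by_cases hξ : ξ ∈ Set.Ioi (0 : ℝ)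
  · have hξ' : 0 < ξ := hξ
    rw [Set.indicator_of_mem hξ, Set.indicator_of_mem hξ, ENNReal.toReal_mul,
      ENNReal.toReal_ofReal (by positivity), ENNReal.toReal_pow, toReal_enorm]
  · rw [Set.indicator_of_notMem hξ, Set.indicator_of_notMem hξ, ENNReal.toReal_zero]

/-- The norm of a horizontal slice of a wavelet transform. -/
lemma integral_norm_sq_transform (k : ℕ) {v : ℝ} (hv : 0 < v) (f : L2R) :
    (v ^ 2)⁻¹ * ∫ u, ‖waveletTransform k f (u, v)‖ ^ 2 =
      ∫ ξ in Set.Ioi (0 : ℝ), 2 * ξ * laguerreFun k (2 * ξ * v) ^ 2 * ‖(𝓕 f : L2R) ξ‖ ^ 2 := by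
  have h1 : StronglyMeasurable fun u => waveletTransform k f (u, v) :=
    (stronglyMeasurable_transform k f).comp_measurable measurable_prodMk_right
  rw [integral_norm_sq_eq_toReal h1.aestronglyMeasurable, eLpNorm_transform k hv,
    ← integral_norm_sq_eq_toReal (memLp_hat_mul k v _).1, ← integral_const_mul,
    ← integral_indicator measurableSet_Ioi]
  refine integral_congr_ae (.of_forall fun ξ => ?_)
  simp only [norm_hat_mul_sq k hv]
  by_cases hξ : ξ ∈ Set.Ioi (0 : ℝ)
  · rw [Set.indicator_of_mem hξ, Set.indicator_of_mem hξ]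
  · rw [Set.indicator_of_notMem hξ, Set.indicator_of_notMem hξ]

/-- Justifies the exchange of integrals below: integrating in `v` first leaves `‖g ξ‖²`, since the
kernel has total mass `1`. -/
lemma integrable_laguerreFun_sq_mul_norm_sq (k : ℕ) (g : L2R) :
    Integrable (fun p : ℝ × ℝ => 2 * p.2 * laguerreFun k (2 * p.2 * p.1) ^ 2 * ‖g p.2‖ ^ 2)
      ((volume.restrict (Set.Ioi 0)).prod (volume.restrict (Set.Ioi 0))) := by
  have hc := (continuous_laguerreFun k).measurable
  have hg : Measurable (g : ℝ → ℂ) := (Lp.stronglyMeasurable g).measurable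
  rw [integrable_prod_iff' (Measurable.aestronglyMeasurable (by fun_prop))]
  constructor
  · filter_upwards [ae_restrict_mem measurableSet_Ioi] with ξ hξ
    have hξ : 0 < ξ := hξ
    exact ((integrableOn_laguerreFun_sq_comp_mul k (b := 2 * ξ) (by positivity)).const_mul
      _).mul_const _
  · refine Integrable.congr (((memLp_two_iff_integrable_sq_norm
      (Lp.aestronglyMeasurable g)).1 (Lp.memLp g)).restrict (s := Set.Ioi 0)) ?_
    filter_upwards [ae_restrict_mem measurableSet_Ioi] with ξ hξ
    have hξ : 0 < ξ := hξ
    have hb : 0 < 2 * ξ := by positivity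
    have h : ∀ x : ℝ, ‖2 * ξ * laguerreFun k (2 * ξ * x) ^ 2 * ‖g ξ‖ ^ 2‖ =
        2 * ξ * laguerreFun k (2 * ξ * x) ^ 2 * ‖g ξ‖ ^ 2 := fun x =>
      Real.norm_of_nonneg (by positivity)
    simp_rw [h]
    rw [integral_mul_const, integral_const_mul,
      integral_comp_mul_left_Ioi (fun y => laguerreFun k y ^ 2) 0 hb, mul_zero, smul_eq_mul,
      ← mul_assoc, mul_inv_cancel₀ hb.ne', one_mul, ← lagConst, lagConst_eq_one, one_mul]

lemma integrable_symbol_mul_norm_sq_transform (k : ℕ) {a : ℝ → ℂ}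
    (ha : MemLp a ∞ (volume.restrict (Set.Ioi 0))) (f : L2R) :
    Integrable (fun p : ℝ × ℝ => a p.2 * ((‖waveletTransform k f p‖ ^ 2 : ℝ) : ℂ)) affineHaar := by
  have h1 : Integrable (fun p => ‖waveletTransform k f p‖ ^ 2) affineHaar :=
    (memLp_two_iff_integrable_sq_norm (memLp_transform k f).1).1 (memLp_transform k f)
  exact h1.ofReal.bdd_mul (memLp_verticalSymbol ha).1
    (ae_norm_le_of_memLp_top (memLp_verticalSymbol ha))

/-- The quadratic form of a vertical symbol on a wavelet transform, in terms of `γ_{a,k}`. -/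
lemma integral_symbol_mul_norm_sq_transform (k : ℕ) {a : ℝ → ℂ}
    (ha : MemLp a ∞ (volume.restrict (Set.Ioi 0))) (f : L2R) :
    ∫ p, a p.2 * ((‖waveletTransform k f p‖ ^ 2 : ℝ) : ℂ) ∂affineHaar =
      ∫ ξ in Set.Ioi (0 : ℝ), gammaFun k a ξ * ((‖(𝓕 f : L2R) ξ‖ ^ 2 : ℝ) : ℂ) := by
  set g : L2R := 𝓕 f with hg
  have hint := integrable_symbol_mul_norm_sq_transform k ha f
  rw [affineHaar] at hint ⊢
  rw [integral_prod_symm _ hint, integral_withDensity_eq_integral_toReal_smul (by fun_prop) (by simp)]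
  have h1 : ∀ v ∈ Set.Ioi (0 : ℝ), (ENNReal.ofReal (v ^ 2)⁻¹).toReal •
      ∫ u, a v * ((‖waveletTransform k f (u, v)‖ ^ 2 : ℝ) : ℂ) =
      ∫ ξ in Set.Ioi (0 : ℝ),
        a v * ((2 * ξ * laguerreFun k (2 * ξ * v) ^ 2 * ‖g ξ‖ ^ 2 : ℝ) : ℂ) := by
    intro v hv
    have hv : 0 < v := hv
    rw [ENNReal.toReal_ofReal (by positivity), integral_const_mul, integral_const_mul,
      integral_complex_ofReal, integral_complex_ofReal, ← integral_norm_sq_transform k hv,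
      Complex.real_smul]
    push_cast; ring
  -- After the exchange, the `v`-integral at fixed `ξ` is `γ_{a,k}(ξ)` in the form of `gammaFun_eq`.
  rw [setIntegral_congr_fun measurableSet_Ioi h1, integral_integral_swap]
  · refine setIntegral_congr_fun measurableSet_Ioi fun ξ hξ => ?_
    rw [gammaFun_eq k a hξ, ← integral_mul_const]
    refine integral_congr_ae (.of_forall fun v => ?_)
    push_cast; ring
  · exact (integrable_laguerreFun_sq_mul_norm_sq k g).ofReal.bdd_mul ha.1.comp_fst
      (Measure.quasiMeasurePreserving_fst.ae (ae_norm_le_of_memLp_top ha))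

lemma mulOp_verticalSymbol {a : ℝ → ℂ} (ha : MemLp a ∞ (volume.restrict (Set.Ioi 0)))
    (F : Lp ℂ 2 affineHaar) :
    mulOp (verticalSymbol a ha) F =ᵐ[affineHaar] fun p => a p.2 * F p := by
  filter_upwards [(ContinuousLinearMap.mul ℂ ℂ).coeFn_holder (r := 2)
    (verticalSymbol a ha) F, (memLp_verticalSymbol ha).coeFn_toLp] with p h1 h2
  rw [verticalSymbol, h2] at h1
  exact h1

/-- The projection disappears because `F` already lies in the subspace. -/
lemma inner_calderonToeplitz (k : ℕ) (b : Lp ℂ ∞ affineHaar) (F : WaveletSpace k) :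
    inner ℂ F (calderonToeplitz k b F) = inner ℂ (incl k F) (mulOp b (incl k F)) :=
  (waveletSubspace k).inner_orthogonalProjectionOnto_eq_of_mem_left F _

/-- Under the isometry `W_k f ↦ 𝓕 f` the operator `T_a^{(k)}` becomes multiplication by
`γ_{a,k}`. -/
theorem calderonToeplitz_verticalSymbol (k : ℕ) {a : ℝ → ℂ}
    (ha : MemLp a ∞ (volume.restrict (Set.Ioi 0))) :
    calderonToeplitz k (verticalSymbol a ha) = multiplierHom k (gammaBCF k ha) := by
  -- By complex polarisation it is enough to compare diagonal values, so only `|W_k f|²` and `|𝓕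
  -- f|²` enter.
  refine ContinuousLinearMap.coe_injective ((ext_inner_map _ _).1 fun F => ?_)
  rw [← inner_conj_symm, ← inner_conj_symm _ F]
  congr 1
  obtain ⟨f, rfl⟩ := transformIsometry_surjective k F
  refine (inner_calderonToeplitz k _ _).trans (Eq.trans ?_ (inner_multiplier k _ _ _).symm)
  rw [spectralIsometry_transformIsometry, L2.inner_def]
  trans ∫ p, a p.2 * ((‖waveletTransform k f p‖ ^ 2 : ℝ) : ℂ) ∂affineHaar
  · refine integral_congr_ae ?_
    filter_upwards [mulOp_verticalSymbol ha (incl k (transformIsometry k f)),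
      incl_transformIsometry k f] with p h1 h2
    rw [h1, h2, RCLike.inner_apply, mul_assoc, Complex.mul_conj']
    push_cast; ring
  · rw [integral_symbol_mul_norm_sq_transform k ha, ← integral_indicator measurableSet_Ioi]
    refine integral_congr_ae (.of_forall fun ξ => ?_)
    simp only [zeroExtend]
    split_ifs with h
    · rw [Set.indicator_of_mem (by exact h), mul_left_comm, Complex.conj_mul', Complex.ofReal_pow]
      rfl
    · rw [Set.indicator_of_notMem (by exact h)]; simp

/-! ### The Toeplitz algebra and its symbol map. -/

/-- The range of `multiplierHom` is a *-subalgebra containing the generators, and it is closed as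
the isometric image of a complete space. -/
lemma toeplitzAlgebra_le_range (k : ℕ) {S : WaveletSpace k →L[ℂ] WaveletSpace k}
    (hS : S ∈ toeplitzAlgebra k verticalSymbols) : ∃ φ, multiplierHom k φ = S := by
  have hclosed : IsClosed (NonUnitalStarAlgHom.range (multiplierHom k) :
      Set (WaveletSpace k →L[ℂ] WaveletSpace k)) := by
    rw [NonUnitalStarAlgHom.coe_range]
    exact (multiplierHom_isometry k).isClosedEmbedding.isClosed_range
  have hle : NonUnitalStarAlgebra.adjoin ℂ (calderonToeplitz k '' verticalSymbols) ≤
      NonUnitalStarAlgHom.range (multiplierHom k) := by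
    refine NonUnitalStarAlgebra.adjoin_le ?_
    rintro _ ⟨_, ⟨a, ha, rfl⟩, rfl⟩
    exact ⟨gammaBCF k ha, (calderonToeplitz_verticalSymbol k ha).symm⟩
  exact NonUnitalStarSubalgebra.topologicalClosure_minimal _ hle hclosed hS

theorem commute_of_mem_toeplitzAlgebra (k : ℕ) {S T : WaveletSpace k →L[ℂ] WaveletSpace k}
    (hS : S ∈ toeplitzAlgebra k verticalSymbols) (hT : T ∈ toeplitzAlgebra k verticalSymbols) :
    S * T = T * S := by
  obtain ⟨φ, rfl⟩ := toeplitzAlgebra_le_range k hS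
  obtain ⟨ψ, rfl⟩ := toeplitzAlgebra_le_range k hT
  rw [← map_mul, ← map_mul, mul_comm]

/-- The function on `ℝ_+` which represents an element of the Toeplitz algebra. -/
noncomputable def toeplitzSymbol (k : ℕ) (S : toeplitzAlgebra k verticalSymbols) :
    BoundedContinuousFunction (Set.Ioi (0 : ℝ)) ℂ :=
  (toeplitzAlgebra_le_range k S.2).choose

/-- Injectivity of `multiplierHom` makes the chosen symbol unique; the algebraic laws of
`toeplitzSymbolHom` follow by applying `multiplierHom` to both sides. -/
lemma multiplierHom_toeplitzSymbol (k : ℕ) (S : toeplitzAlgebra k verticalSymbols) :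
    multiplierHom k (toeplitzSymbol k S) = S :=
  (toeplitzAlgebra_le_range k S.2).choose_spec

/-- The isometric *-homomorphism `τ_∞^{(k)}`. -/
noncomputable def toeplitzSymbolHom (k : ℕ) : toeplitzAlgebra k verticalSymbols →⋆ₙₐ[ℂ]
    BoundedContinuousFunction (Set.Ioi (0 : ℝ)) ℂ where
  toFun := toeplitzSymbol k
  map_smul' c S := multiplierHom_injective k <| by
    rw [map_smul]; simp only [multiplierHom_toeplitzSymbol]; rfl
  map_zero' := multiplierHom_injective k <| by
    rw [map_zero]; simp only [multiplierHom_toeplitzSymbol]; rfl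
  map_add' S T := multiplierHom_injective k <| by
    rw [map_add]; simp only [multiplierHom_toeplitzSymbol]; rfl
  map_mul' S T := multiplierHom_injective k <| by
    rw [map_mul]; simp only [multiplierHom_toeplitzSymbol]; rfl
  map_star' S := multiplierHom_injective k <| by
    rw [map_star]; simp only [multiplierHom_toeplitzSymbol]; rfl

lemma toeplitzSymbolHom_isometry (k : ℕ) : Isometry (toeplitzSymbolHom k) := by
  refine Isometry.of_dist_eq fun S T => ?_
  rw [← (multiplierHom_isometry k).dist_eq]
  change dist (multiplierHom k (toeplitzSymbol k S)) (multiplierHom k (toeplitzSymbol k T)) = _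
  rw [multiplierHom_toeplitzSymbol, multiplierHom_toeplitzSymbol]
  rfl

lemma toeplitzSymbolHom_calderonToeplitz (k : ℕ) {a : ℝ → ℂ}
    (ha : MemLp a ∞ (volume.restrict (Set.Ioi 0))) :
    toeplitzSymbolHom k ⟨calderonToeplitz k (verticalSymbol a ha),
      calderonToeplitz_mem k ⟨a, ha, rfl⟩⟩ = gammaBCF k ha :=
  multiplierHom_injective k <|
    (multiplierHom_toeplitzSymbol k _).trans (calderonToeplitz_verticalSymbol k ha)

/-- Continuous *-homomorphisms on the Toeplitz algebra which agree on the generators are equal. -/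
lemma toeplitzAlgebra_hom_ext (k : ℕ) {B : Type*} [NonUnitalSemiring B] [StarRing B] [Module ℂ B]
    [TopologicalSpace B] [T2Space B] {𝒜 : Set (Lp ℂ ∞ affineHaar)}
    {σ τ : toeplitzAlgebra k 𝒜 →⋆ₙₐ[ℂ] B} (hσ : Continuous σ) (hτ : Continuous τ)
    (h : ∀ a, ∀ ha : a ∈ 𝒜, σ ⟨calderonToeplitz k a, calderonToeplitz_mem k ha⟩ =
      τ ⟨calderonToeplitz k a, calderonToeplitz_mem k ha⟩) : σ = τ := by
  have hle := NonUnitalStarSubalgebra.le_topologicalClosure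
    (NonUnitalStarAlgebra.adjoin ℂ (calderonToeplitz k '' 𝒜))
  have h1 : ∀ S (hS : S ∈ NonUnitalStarAlgebra.adjoin ℂ (calderonToeplitz k '' 𝒜)),
      σ ⟨S, hle hS⟩ = τ ⟨S, hle hS⟩ := by
    intro S hS
    induction hS using NonUnitalStarAlgebra.adjoin_induction with
    | mem S hS => obtain ⟨a, ha, rfl⟩ := hS; exact h a ha
    | zero => exact (map_zero σ).trans (map_zero τ).symm
    | add S T hS hT h1 h2 =>
      have e := map_add σ ⟨S, hle hS⟩ ⟨T, hle hT⟩
      rw [h1, h2, ← map_add] at e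
      exact e
    | mul S T hS hT h1 h2 =>
      have e := map_mul σ ⟨S, hle hS⟩ ⟨T, hle hT⟩
      rw [h1, h2, ← map_mul] at e
      exact e
    | smul c S hS h1 =>
      have e := map_smul σ c ⟨S, hle hS⟩
      rw [h1, ← map_smul] at e
      exact e
    | star S hS h1 =>
      have e := map_star σ ⟨S, hle hS⟩
      rw [h1, ← map_star] at e
      exact e
  have h2 : IsClosed {S | σ S = τ S} := isClosed_eq hσ hτ
  refine DFunLike.ext _ _ fun S => ?_
  -- The agreement set is closed and contains the algebraically generated *-subalgebra, which is
  -- dense by the definition of `toeplitzAlgebra`.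
  have h3 : S ∈ closure {S | σ S = τ S} := by
    rw [closure_subtype]
    refine closure_mono ?_ S.2
    exact fun T hT => ⟨⟨T, hle hT⟩, h1 T hT, rfl⟩
  rwa [h2.closure_eq] at h3

end CalderonToeplitz

theorem mainTheorem7 (k : ℕ) :
    (∀ S ∈ toeplitzAlgebra k verticalSymbols, ∀ T ∈ toeplitzAlgebra k verticalSymbols,
      S * T = T * S) ∧
    (∀ a : ℝ → ℂ, MemLp a ∞ (volume.restrict (Set.Ioi 0)) → ∀ ξ : ℝ, 0 < ξ →
      IntegrableOn (fun v => a (v / (2 * ξ)) * ((laguerreFun k v ^ 2 : ℝ) : ℂ)) (Set.Ioi 0)) ∧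
    ∃! τ : toeplitzAlgebra k verticalSymbols →⋆ₙₐ[ℂ]
        BoundedContinuousFunction (Set.Ioi (0 : ℝ)) ℂ,
      Isometry τ ∧
      ∀ (a : ℝ → ℂ) (ha : MemLp a ∞ (volume.restrict (Set.Ioi 0))) (ξ : Set.Ioi (0 : ℝ)),
        τ ⟨calderonToeplitz k (verticalSymbol a ha),
          calderonToeplitz_mem k ⟨a, ha, rfl⟩⟩ ξ = gammaFun k a ξ := by
  refine ⟨fun S hS T hT => commute_of_mem_toeplitzAlgebra k hS hT,
    fun a ha ξ hξ => integrableOn_gamma k ha hξ, toeplitzSymbolHom k,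
    ⟨toeplitzSymbolHom_isometry k, fun a ha ξ => ?_⟩, fun τ hτ => ?_⟩
  · rw [toeplitzSymbolHom_calderonToeplitz k ha]; rfl
  -- For uniqueness the isometry condition serves only to provide continuity.
  · refine toeplitzAlgebra_hom_ext k hτ.1.continuous (toeplitzSymbolHom_isometry k).continuous ?_
    rintro _ ⟨a, ha, rfl⟩
    ext ξ
    rw [hτ.2, toeplitzSymbolHom_calderonToeplitz k ha]; rfl
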